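/- Conventions. All Hilbert spaces are over the same field ($\mathbb R$ or $\mathbb C$). A Hilbert space $\mathcal H_+$ is *closely embedded* in a Hilbert space $\mathcal H$ with *closed embedding* $j$ if $j$ is a closed operator from $\mathcal H_+$ to $\mathcal H$ whose domain is a linear manifold $\operatorname{Dom}(j)\subseteq\mathcal H_+\cap\mathcal H$, dense in $\mathcal H_+$, on which the linear structures of $\mathcal H_+$ and $\mathcal H$ agree, and $jx=x$ for all $x\in\operatorname{Dom}(j)$. (The spaces involved are regarded as linear subspaces of a common vector space, without any relation between their norms.) A *triplet of closely embedded Hilbert spaces* $(\mathcal H_+;\mathcal H_0;\mathcal H_-)$ consists of Hilbert spaces such that (th1) $\mathcal H_+$ is closely embedded in $\mathcal H_0$, with closed embedding $j_+$, and $\operatorname{Ran}(j_+)$ is dense in $\mathcal H_0$; (th2) $\mathcal H_0$ is closely embedded in $\mathcal H_-$, with closed embedding $j_-$, and $\operatorname{Ran}(j_-)$ is dense in $\mathcal H_-$; (th3) $\operatorname{Dom}(j_+^*)\subseteq\operatorname{Dom}(j_-)$ and, for every $y\in\operatorname{Dom}(j_-)$, $$\|y\|_-=\sup\Bigl\{\frac{|\langle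 x,y\rangle_{\mathcal H_0}|}{\|x\|_+}\;:\;x\in\operatorname{Dom}(j_+),\ x\neq0\Bigr\},$$ the supremum being taken in $[0,\infty)$ (so $\sup\emptyset=0$). The *kernel operator* of the triplet is $A=j_+j_+^*$ (with its natural domain), an operator in $\mathcal H_0$, and its *Hamiltonian* is $H=A^{-1}$. **Proposition.** Let $(\mathcal H_+;\mathcal H_0;\mathcal H_-)$ be a triplet of closely embedded Hilbert spaces, with closed embeddings $j_+$ of $\mathcal H_+$ in $\mathcal H_0$ and $j_-$ of $\mathcal H_0$ in $\mathcal H_-$, kernel operator $A$ and Hamiltonian $H$. Then $(\mathcal H_-;\mathcal H_0;\mathcal H_+)$ is also a triplet of closely embedded Hilbert spaces; more precisely: (1) $j_-^{-1}$ and $j_+^{-1}$ (with domains $\operatorname{Ran}(j_-)$ and $\operatorname{Ran}(j_+)$) are the closed embeddings of $\mathcal H_-$ in $\mathcal H_0$ and, respectively, of $\mathcal H_0$ in $\mathcal H_+$, of this triplet; (2) $A$ is the Hamiltonian and $H$ is the kernel operator of the triplet $(\mathcal H_-;\mathcal H_0;\mathcal H_+)$. -/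

import Mathlib

noncomputable section

namespace CloselyEmbedded

variable {𝕜 E F G V : Type*} [RCLike 𝕜]
variable [NormedAddCommGroup E] [InnerProductSpace 𝕜 E]
variable [NormedAddCommGroup F] [InnerProductSpace 𝕜 F]
variable [NormedAddCommGroup G] [InnerProductSpace 𝕜 G]
variable [AddCommGroup V] [Module 𝕜 V]

/-- The product `g f` of two partially defined operators, with its natural (maximal) domain
`{x ∈ Dom f | f x ∈ Dom g}`. (Mathlib's `LinearPMap.comp` asks for `Ran f ⊆ Dom g`.) -/
def opMul (g : F →ₗ.[𝕜] G) (f : E →ₗ.[𝕜] F) : E →ₗ.[𝕜] G where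
  domain :=
    { carrier := {x | ∃ h : x ∈ f.domain, f ⟨x, h⟩ ∈ g.domain}
      zero_mem' := ⟨f.domain.zero_mem, by
        have h : f ⟨0, f.domain.zero_mem⟩ = 0 := f.map_zero
        rw [h]; exact g.domain.zero_mem⟩
      add_mem' := by
        rintro x y ⟨hx, hx'⟩ ⟨hy, hy'⟩
        refine ⟨f.domain.add_mem hx hy, ?_⟩
        have h : f ⟨x + y, f.domain.add_mem hx hy⟩ = f ⟨x, hx⟩ + f ⟨y, hy⟩ :=
          f.map_add ⟨x, hx⟩ ⟨y, hy⟩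
        rw [h]; exact g.domain.add_mem hx' hy'
      smul_mem' := by
        rintro c x ⟨hx, hx'⟩
        refine ⟨f.domain.smul_mem c hx, ?_⟩
        have h : f ⟨c • x, f.domain.smul_mem c hx⟩ = c • f ⟨x, hx⟩ := f.map_smul c ⟨x, hx⟩
        rw [h]; exact g.domain.smul_mem c hx' }
  toFun :=
    { toFun := fun x => g ⟨f ⟨x.1, x.2.1⟩, x.2.2⟩
      map_add' := fun x y => by
        rw [← g.map_add]
        congr 1
        exact Subtype.ext (f.map_add ⟨x.1, x.2.1⟩ ⟨y.1, y.2.1⟩)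
      map_smul' := fun c x => by
        rw [RingHom.id_apply, ← g.map_smul]
        congr 1
        exact Subtype.ext (f.map_smul c ⟨x.1, x.2.1⟩) }

/-- `E` is closely embedded in `F`, with closed embedding `j`.
The two spaces are regarded as linear subspaces of a vector space `V` through the (injective)
linear maps `ιE` and `ιF`. The operator `j`, from `E` to `F`, is defined on a linear manifold
`Dom j ⊆ E ∩ F` that is dense in `E`, it acts by `j x = x`, and it is closed. -/
structure IsClosedEmbedding (ιE : E →ₗ[𝕜] V) (ιF : F →ₗ[𝕜] V) (j : E →ₗ.[𝕜] F) : Prop where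
  dense_domain : Dense (j.domain : Set E)
  apply_eq : ∀ x : j.domain, ιF (j x) = ιE (x : E)
  closed : j.IsClosed

/-- `(E; F; G)` is a triplet of closely embedded Hilbert spaces, with closed embeddings
`jp` of `E` in `F` and `jm` of `F` in `G`; the three spaces are regarded as linear subspaces of
a vector space `V` through `ιE`, `ιF`, `ιG`.
The supremum in `norm_eq` is taken in `[0, ∞)`; so it is `0` if `E` is the zero space. -/
structure IsTriplet [CompleteSpace E] (ιE : E →ₗ[𝕜] V) (ιF : F →ₗ[𝕜] V) (ιG : G →ₗ[𝕜] V)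
    (jp : E →ₗ.[𝕜] F) (jm : F →ₗ.[𝕜] G) : Prop where
  left_embedding : IsClosedEmbedding ιE ιF jp
  left_dense_range : DenseRange jp
  right_embedding : IsClosedEmbedding ιF ιG jm
  right_dense_range : DenseRange jm
  adjoint_domain_le : jp.adjoint.domain ≤ jm.domain
  norm_eq : ∀ y : jm.domain,
    IsLUB {r : NNReal | ∃ x : jp.domain, x ≠ 0 ∧ r = ‖inner 𝕜 (jp x) (y : F)‖₊ / ‖(x : E)‖₊}
      ‖jm y‖₊

/-- The kernel operator `A = j j*` in `F` of a closed embedding `j` of `E` in `F`; the kernel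
operator of a triplet is that of its first closed embedding. -/
def kernelOperator [CompleteSpace E] (j : E →ₗ.[𝕜] F) : F →ₗ.[𝕜] F :=
  opMul j j.adjoint

/-- The Hamiltonian `H = A⁻¹` in `F` of a triplet whose first closed embedding is `j`. -/
def hamiltonian [CompleteSpace E] (j : E →ₗ.[𝕜] F) : F →ₗ.[𝕜] F :=
  (kernelOperator j).inverse

end CloselyEmbedded

end

/-! Condition (th3) says exactly that `jm` and `jp.adjoint` have the same domain and the same norms
(`IsTriplet.adjoint_domain_eq`, `IsTriplet.norm_apply_eq`). Both ranges are dense, so `jm = U jp*`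
for a unitary `U` from `Hp` onto `Hm`. Hence `(jm⁻¹)* = U jp⁻¹`, with domain `Ran jp`, and `jm⁻¹
(jm⁻¹)* = (jp jp*)⁻¹`, which is the swapped triplet and its kernel operator. `U` is never built:
equality of norms and, by polarization, of inner products replaces it. The analytic input is `jp** =
jp` for closed `jp`, used on graphs. -/

open LinearPMap

/-! ### Inverses, products and adjoints through graphs -/

section Graph

variable {𝕜 E F G : Type*} [RCLike 𝕜]
variable [NormedAddCommGroup E] [InnerProductSpace 𝕜 E]
variable [NormedAddCommGroup F] [InnerProductSpace 𝕜 F]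
variable [NormedAddCommGroup G] [InnerProductSpace 𝕜 G]

theorem LinearPMap.mem_inverse_graph_iff {f : E →ₗ.[𝕜] F} (hf : LinearMap.ker f.toFun = ⊥)
    {x : E} {y : F} : (y, x) ∈ f.inverse.graph ↔ (x, y) ∈ f.graph := by
  rw [inverse_graph hf, Submodule.mem_map]
  constructor
  · rintro ⟨⟨a, b⟩, hab, h⟩
    obtain ⟨rfl, rfl⟩ := Prod.mk.inj h
    exact hab
  · exact fun h => ⟨(x, y), h, rfl⟩

theorem LinearPMap.inverse_ker {f : E →ₗ.[𝕜] F} (hf : LinearMap.ker f.toFun = ⊥) :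
    LinearMap.ker f.inverse.toFun = ⊥ := by
  rw [LinearMap.ker_eq_bot']
  intro y hy
  have h : ((y : F), (0 : E)) ∈ f.inverse.graph := by
    have := f.inverse.mem_graph y
    rwa [show f.inverse y = 0 from hy] at this
  rw [mem_inverse_graph_iff hf] at h
  exact Subtype.ext (f.graph_fst_eq_zero_snd h rfl)

theorem LinearPMap.inverse_inverse {f : E →ₗ.[𝕜] F} (hf : LinearMap.ker f.toFun = ⊥) :
    f.inverse.inverse = f := by
  refine eq_of_eq_graph (Submodule.ext fun ⟨x, y⟩ => ?_)
  rw [mem_inverse_graph_iff (inverse_ker hf), mem_inverse_graph_iff hf]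

theorem LinearPMap.ker_eq_bot_of_graph {f : E →ₗ.[𝕜] F}
    (hf : ∀ x, (x, (0 : F)) ∈ f.graph → x = 0) : LinearMap.ker f.toFun = ⊥ := by
  rw [LinearMap.ker_eq_bot']
  intro x hx
  refine Subtype.ext (hf x ?_)
  have := f.mem_graph x
  rwa [show f x = 0 from hx] at this

theorem CloselyEmbedded.mem_opMul_graph_iff (g : F →ₗ.[𝕜] G) (f : E →ₗ.[𝕜] F) {x : E} {z : G} :
    (x, z) ∈ (CloselyEmbedded.opMul g f).graph ↔
      ∃ y, (x, y) ∈ f.graph ∧ (y, z) ∈ g.graph := by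
  constructor
  · intro h
    obtain ⟨⟨x', h1, h2⟩, rfl, rfl⟩ := (mem_graph_iff _).1 h
    exact ⟨f ⟨x', h1⟩, f.mem_graph ⟨x', h1⟩, g.mem_graph ⟨_, h2⟩⟩
  · rintro ⟨y, hy, hz⟩
    obtain ⟨x', rfl, rfl⟩ := (mem_graph_iff _).1 hy
    obtain ⟨y', hy', rfl⟩ := (mem_graph_iff _).1 hz
    have h2 : f x' ∈ g.domain := by
      have := y'.2
      rwa [hy'] at this
    refine (mem_graph_iff _).2 ⟨⟨x', x'.2, h2⟩, rfl, ?_⟩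
    exact congrArg g (Subtype.ext hy'.symm)

theorem LinearPMap.mem_adjoint_graph_iff [CompleteSpace E] {T : E →ₗ.[𝕜] F}
    (hT : Dense (T.domain : Set E)) {y : F} {v : E} :
    (y, v) ∈ T.adjoint.graph ↔ ∀ x : T.domain, inner 𝕜 (x : E) v = inner 𝕜 (T x) y := by
  rw [adjoint_graph_eq_graph_adjoint hT, Submodule.mem_adjoint_iff]
  constructor
  · exact fun h x => (sub_eq_zero.1 (h _ _ (T.mem_graph x))).symm
  · intro h a b hab
    obtain ⟨x, rfl, rfl⟩ := (mem_graph_iff _).1 hab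
    exact sub_eq_zero.2 (h x).symm

/-- A closed operator contains its second adjoint. -/
theorem LinearPMap.IsClosed.mem_graph_of_forall_inner_adjoint [CompleteSpace E] [CompleteSpace F]
    {T : E →ₗ.[𝕜] F} (hT : Dense (T.domain : Set E)) (hc : T.IsClosed) {w : E} {y : F}
    (h : ∀ z : T.adjoint.domain, inner 𝕜 (T.adjoint z) w = inner 𝕜 (z : F) y) :
    (w, y) ∈ T.graph := by
  -- The graph is moved to the Hilbert sum, where closedness gives `Kᗮᗮ = K`.
  let K : Submodule 𝕜 (WithLp 2 (E × F)) :=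
    T.graph.comap (WithLp.linearEquiv 2 𝕜 (E × F)).toLinearMap
  have hK : _root_.IsClosed (K : Set (WithLp 2 (E × F))) :=
    IsClosed.preimage (WithLp.prod_continuous_ofLp 2 E F) hc
  have : CompleteSpace K := hK.completeSpace_coe
  suffices WithLp.toLp 2 (w, y) ∈ K from this
  rw [← Submodule.orthogonal_orthogonal K, Submodule.mem_orthogonal]
  intro u hu
  rw [Submodule.mem_orthogonal] at hu
  -- The orthogonal complement of the graph of `T` is the rotated graph of `T*`.
  have hmem : (u.snd, -u.fst) ∈ T.adjoint.graph := by
    rw [mem_adjoint_graph_iff hT]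
    intro x
    have := hu (WithLp.toLp 2 ((x : E), T x)) (T.mem_graph x)
    rw [WithLp.prod_inner_apply] at this
    rw [inner_neg_right]
    exact neg_eq_of_add_eq_zero_right this
  obtain ⟨z, hz, hz'⟩ := (mem_graph_iff _).1 hmem
  have := h z
  rw [hz', hz] at this
  rw [WithLp.prod_inner_apply]
  simp only [inner_neg_left] at this
  exact add_eq_zero_iff_neg_eq.2 this

/-- The orthogonal complement of `Ran T*` is `ker T** = ker T = 0`. -/
theorem LinearPMap.dense_range_adjoint [CompleteSpace E] [CompleteSpace F] {T : E →ₗ.[𝕜] F}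
    (hT : Dense (T.domain : Set E)) (hc : T.IsClosed) (hk : LinearMap.ker T.toFun = ⊥) :
    Dense ((LinearMap.range T.adjoint.toFun : Submodule 𝕜 E) : Set E) := by
  rw [Submodule.dense_iff_topologicalClosure_eq_top, Submodule.topologicalClosure_eq_top_iff,
    Submodule.eq_bot_iff]
  intro x hx
  have h0 : (x, (0 : F)) ∈ T.graph := hc.mem_graph_of_forall_inner_adjoint hT fun z => by
    rw [inner_zero_right]
    exact (Submodule.mem_orthogonal _ _).1 hx _ ⟨z, rfl⟩
  obtain ⟨x', hx', h'⟩ := (mem_graph_iff _).1 h0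
  rw [show x = (x' : E) from hx'.symm, (LinearMap.ker_eq_bot'.1 hk) x' h']
  rfl

theorem LinearPMap.eq_zero_of_mem_adjoint_graph [CompleteSpace E] {T : E →ₗ.[𝕜] F}
    (hT : Dense (T.domain : Set E)) (hr : DenseRange T) {z : F}
    (hz : (z, (0 : E)) ∈ T.adjoint.graph) : z = 0 := by
  rw [mem_adjoint_graph_iff hT] at hz
  refine Dense.eq_zero_of_inner_right (S := Set.range T) 𝕜 hr ?_
  rintro _ ⟨x, rfl⟩
  exact (hz x).symm.trans (inner_zero_right _)

end Graph

/-! ### Norms as suprema, and polarization -/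

section Norm

variable {𝕜 E F : Type*} [RCLike 𝕜]
variable [NormedAddCommGroup E] [InnerProductSpace 𝕜 E]
variable [NormedAddCommGroup F] [InnerProductSpace 𝕜 F]

/-- The norm of a vector is the supremum of `|⟨z, w⟩| / ‖z‖` over a dense subspace. -/
theorem isLUB_nnnorm_inner_div {K : Submodule 𝕜 E} (hK : Dense (K : Set E)) (w : E) :
    IsLUB {r : NNReal | ∃ z ∈ K, z ≠ 0 ∧ r = ‖inner 𝕜 z w‖₊ / ‖z‖₊} ‖w‖₊ := by
  constructor
  · rintro _ ⟨z, -, hz, rfl⟩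
    rw [div_le_iff₀ (nnnorm_pos.2 hz), mul_comm]
    exact nnnorm_inner_le_nnnorm z w
  · intro b hb
    have hbK : ∀ z ∈ K, ‖inner 𝕜 z w‖₊ ≤ b * ‖z‖₊ := by
      intro z hz
      by_cases h0 : z = 0
      · simp [h0]
      · rw [← div_le_iff₀ (nnnorm_pos.2 h0)]
        exact hb ⟨z, hz, h0, rfl⟩
    have hcl : IsClosed {z : E | ‖inner 𝕜 z w‖₊ ≤ b * ‖z‖₊} :=
      isClosed_le (by fun_prop) (by fun_prop)
    -- The bound passes from `K` to its closure, so it may be tested at `w` itself.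
    have hw : ‖inner 𝕜 w w‖ ≤ b * ‖w‖ := hcl.closure_subset_iff.2 hbK (hK w)
    rw [inner_self_eq_norm_sq_to_K, norm_pow, RCLike.norm_ofReal, abs_norm, sq] at hw
    rcases eq_or_ne w 0 with rfl | h0
    · simp
    · exact NNReal.coe_le_coe.1 (le_of_mul_le_mul_right hw (norm_pos_iff.2 h0))

theorem inner_map_eq_inner_map_of_norm_eq {D : Type*} [AddCommGroup D] [Module 𝕜 D]
    (f : D →ₗ[𝕜] E) (g : D →ₗ[𝕜] F) (h : ∀ x, ‖f x‖ = ‖g x‖) (x y : D) :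
    inner 𝕜 (f x) (f y) = inner 𝕜 (g x) (g y) := by
  rw [inner_eq_sum_norm_sq_div_four, inner_eq_sum_norm_sq_div_four]
  simp only [← _root_.map_add, ← _root_.map_sub, ← _root_.map_smul, h]

end Norm

namespace CloselyEmbedded

/-! ### Inverse of a closed embedding -/

section Embedding

variable {𝕜 E F V : Type*} [RCLike 𝕜]
variable [NormedAddCommGroup E] [InnerProductSpace 𝕜 E]
variable [NormedAddCommGroup F] [InnerProductSpace 𝕜 F]
variable [AddCommGroup V] [Module 𝕜 V]
variable {ιE : E →ₗ[𝕜] V} {ιF : F →ₗ[𝕜] V} {j : E →ₗ.[𝕜] F}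

theorem IsClosedEmbedding.ker_eq_bot (hj : IsClosedEmbedding ιE ιF j)
    (hE : Function.Injective ιE) : LinearMap.ker j.toFun = ⊥ := by
  rw [LinearMap.ker_eq_bot']
  intro x hx
  have h := hj.apply_eq x
  rw [show j x = 0 from hx, _root_.map_zero] at h
  exact Subtype.ext (hE (by rw [← h]; exact (_root_.map_zero ιE).symm))

theorem IsClosedEmbedding.inverse (hj : IsClosedEmbedding ιE ιF j)
    (hE : Function.Injective ιE) (hr : DenseRange j) : IsClosedEmbedding ιF ιE j.inverse := by
  have hk := hj.ker_eq_bot hE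
  refine ⟨?_, fun y => ?_, (inverse_closed_iff hk).2 hj.closed⟩
  · rw [inverse_domain]
    exact hr
  · have h := (mem_inverse_graph_iff hk).1 (j.inverse.mem_graph y)
    obtain ⟨x, hx, hx'⟩ := (mem_graph_iff _).1 h
    dsimp only at hx hx'
    rw [← hx, ← hx', hj.apply_eq]

theorem IsClosedEmbedding.denseRange_inverse (hj : IsClosedEmbedding ιE ιF j)
    (hE : Function.Injective ιE) : DenseRange j.inverse := by
  have h := hj.dense_domain
  rw [← inverse_range (hj.ker_eq_bot hE)] at h
  exact h

end Embedding

/-! ### The reversed triplet -/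

section Triplet

variable {𝕜 Hp H₀ Hm V : Type*} [RCLike 𝕜]
variable [NormedAddCommGroup Hp] [InnerProductSpace 𝕜 Hp] [CompleteSpace Hp]
variable [NormedAddCommGroup H₀] [InnerProductSpace 𝕜 H₀]
variable [NormedAddCommGroup Hm] [InnerProductSpace 𝕜 Hm]
variable [AddCommGroup V] [Module 𝕜 V]
variable {ιp : Hp →ₗ[𝕜] V} {ι₀ : H₀ →ₗ[𝕜] V} {ιm : Hm →ₗ[𝕜] V}
variable {jp : Hp →ₗ.[𝕜] H₀} {jm : H₀ →ₗ.[𝕜] Hm}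

/-- The supremum in (th3) is finite, so `x ↦ ⟨y, jp x⟩` is bounded. -/
theorem IsTriplet.domain_le_adjoint_domain (h : IsTriplet ιp ι₀ ιm jp jm) :
    jm.domain ≤ jp.adjoint.domain := by
  intro y hy
  rw [mem_adjoint_domain_iff]
  refine AddMonoidHomClass.continuous_of_bound _ ‖jm ⟨y, hy⟩‖ fun x => ?_
  change ‖inner 𝕜 y (jp x)‖ ≤ _
  rcases eq_or_ne x 0 with rfl | hx
  · simp
  · have hx' : (x : Hp) ≠ 0 := fun h0 => hx (Subtype.ext h0)
    have hb := (h.norm_eq ⟨y, hy⟩).1 ⟨x, hx, rfl⟩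
    rw [div_le_iff₀ (nnnorm_pos.2 hx')] at hb
    rw [norm_inner_symm]
    exact hb

theorem IsTriplet.adjoint_domain_eq (h : IsTriplet ιp ι₀ ιm jp jm) :
    jp.adjoint.domain = jm.domain :=
  le_antisymm h.adjoint_domain_le h.domain_le_adjoint_domain

/-- Since `⟨jp x, y⟩ = ⟨x, jp* y⟩`, the supremum in (th3) is the norm of `jp* y` tested on the dense
subspace `Dom jp`. -/
theorem IsTriplet.norm_apply_eq (h : IsTriplet ιp ι₀ ιm jp jm) (y : jm.domain) :
    ‖jm y‖ = ‖jp.adjoint (Submodule.inclusion h.domain_le_adjoint_domain y)‖ := by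
  set z := Submodule.inclusion h.domain_le_adjoint_domain y with hz
  have hT := h.left_embedding.dense_domain
  have key := isLUB_nnnorm_inner_div (𝕜 := 𝕜) hT (jp.adjoint z)
  have hin := (mem_adjoint_graph_iff hT).1 (jp.adjoint.mem_graph z)
  have hset : {r : NNReal | ∃ x : jp.domain, x ≠ 0 ∧
      r = ‖inner 𝕜 (jp x) (y : H₀)‖₊ / ‖(x : Hp)‖₊} =
      {r : NNReal | ∃ x ∈ jp.domain, x ≠ 0 ∧
        r = ‖inner 𝕜 x (jp.adjoint z)‖₊ / ‖x‖₊} := by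
    ext r
    constructor
    · rintro ⟨x, hx, rfl⟩
      refine ⟨x, x.2, fun h0 => hx (Subtype.ext h0), ?_⟩
      rw [hin x]
      rfl
    · rintro ⟨x, hxd, hx, rfl⟩
      refine ⟨⟨x, hxd⟩, fun h0 => hx (congrArg Subtype.val h0), ?_⟩
      rw [← show inner 𝕜 x _ = inner 𝕜 (jp ⟨x, hxd⟩) (y : H₀) from hin ⟨x, hxd⟩]
  have hy := h.norm_eq y
  rw [hset] at hy
  exact congrArg NNReal.toReal (hy.unique key)

theorem IsTriplet.inner_apply_eq (h : IsTriplet ιp ι₀ ιm jp jm) (y z : jm.domain) :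
    inner 𝕜 (jm y) (jm z) =
      inner 𝕜 (jp.adjoint (Submodule.inclusion h.domain_le_adjoint_domain y))
        (jp.adjoint (Submodule.inclusion h.domain_le_adjoint_domain z)) :=
  inner_map_eq_inner_map_of_norm_eq jm.toFun
    (jp.adjoint.toFun.comp (Submodule.inclusion h.domain_le_adjoint_domain)) h.norm_apply_eq y z

theorem IsTriplet.kernelOperator_ker_eq_bot (h : IsTriplet ιp ι₀ ιm jp jm)
    (hιp : Function.Injective ιp) : LinearMap.ker (kernelOperator jp).toFun = ⊥ := by
  refine ker_eq_bot_of_graph fun z hz => ?_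
  obtain ⟨u, hzu, hu⟩ := (mem_opMul_graph_iff _ _).1 hz
  rw [← mem_inverse_graph_iff (h.left_embedding.ker_eq_bot hιp)] at hu
  obtain rfl := graph_fst_eq_zero_snd _ hu rfl
  exact eq_zero_of_mem_adjoint_graph h.left_embedding.dense_domain h.left_dense_range hzu

variable [CompleteSpace H₀]

/-- For `y = jp w` and `x = jm z` the quotient is `|⟨jp* z, w⟩| / ‖jp* z‖`; the vectors `jp* z` fill
the dense subspace `Ran jp*`, so the supremum is `‖w‖`. -/
theorem IsTriplet.isLUB_inverse (h : IsTriplet ιp ι₀ ιm jp jm)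
    (hιp : Function.Injective ιp) (hι₀ : Function.Injective ι₀) (y : jp.inverse.domain) :
    IsLUB {r : NNReal | ∃ x : jm.inverse.domain, x ≠ 0 ∧
      r = ‖inner 𝕜 (jm.inverse x) (y : H₀)‖₊ / ‖(x : Hm)‖₊} ‖jp.inverse y‖₊ := by
  have hkm := h.right_embedding.ker_eq_bot hι₀
  have hT := h.left_embedding.dense_domain
  have hkp := h.left_embedding.ker_eq_bot hιp
  obtain ⟨w, hw, hw'⟩ :=
    (mem_graph_iff _).1 ((mem_inverse_graph_iff hkp).1 (jp.inverse.mem_graph y))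
  dsimp only at hw hw'
  have key := isLUB_nnnorm_inner_div (𝕜 := 𝕜)
    (dense_range_adjoint hT h.left_embedding.closed hkp) (jp.inverse y)
  have hin : ∀ z : jm.domain,
      inner 𝕜 (jp.adjoint (Submodule.inclusion h.domain_le_adjoint_domain z)) (jp.inverse y) =
        inner 𝕜 (z : H₀) (y : H₀) := by
    intro z
    rw [← hw, ← hw']
    exact adjoint_isFormalAdjoint hT _ w
  convert key using 1
  ext r
  constructor
  · rintro ⟨x, hx, rfl⟩
    obtain ⟨z, hz, hz'⟩ :=
      (mem_graph_iff _).1 ((mem_inverse_graph_iff hkm).1 (jm.inverse.mem_graph x))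
    dsimp only at hz hz'
    have hn : ‖(x : Hm)‖₊ =
        ‖jp.adjoint (Submodule.inclusion h.domain_le_adjoint_domain z)‖₊ := by
      rw [← hz']
      exact Subtype.ext (h.norm_apply_eq z)
    refine ⟨_, ⟨Submodule.inclusion h.domain_le_adjoint_domain z, rfl⟩, ?_, ?_⟩
    · exact nnnorm_ne_zero_iff.1 (hn ▸ nnnorm_ne_zero_iff.2 fun h0 => hx (Subtype.ext h0))
    · rw [hn, ← hz, ← hin z]
      rfl
  · rintro ⟨_, ⟨z₀, rfl⟩, h0, rfl⟩
    let z : jm.domain := ⟨z₀, h.adjoint_domain_le z₀.2⟩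
    obtain ⟨x, hx, hx'⟩ := (mem_graph_iff _).1 (mem_inverse_graph hkm z)
    dsimp only at hx hx'
    have hn : ‖(x : Hm)‖₊ = ‖jp.adjoint.toFun z₀‖₊ := by
      rw [hx]
      exact Subtype.ext (h.norm_apply_eq z)
    refine ⟨x, fun hx0 => h0 ?_, ?_⟩
    · rw [← nnnorm_eq_zero, ← hn, hx0]
      exact nnnorm_zero
    · rw [hn, hx', ← hin z]
      rfl

variable [CompleteSpace Hm]

/-- `Dom((j₋⁻¹)*) ⊆ Ran(j₊)`. -/
theorem IsTriplet.adjoint_inverse_domain_le (h : IsTriplet ιp ι₀ ιm jp jm)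
    (hιp : Function.Injective ιp) (hι₀ : Function.Injective ι₀) :
    jm.inverse.adjoint.domain ≤ jp.inverse.domain := by
  intro y hy
  have hkm := h.right_embedding.ker_eq_bot hι₀
  have hT := h.left_embedding.dense_domain
  have hkp := h.left_embedding.ker_eq_bot hιp
  have hSd := (h.right_embedding.inverse hι₀ h.right_dense_range).dense_domain
  set v := jm.inverse.adjoint ⟨y, hy⟩
  have hvS := (mem_adjoint_graph_iff hSd).1 (jm.inverse.adjoint.mem_graph ⟨y, hy⟩)
  have hv' : ∀ z : jm.domain, inner 𝕜 (jm z) v = inner 𝕜 (z : H₀) y := by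
    intro z
    obtain ⟨u, hu, hu'⟩ := (mem_graph_iff _).1 (mem_inverse_graph hkm z)
    have := hvS u
    rwa [hu, hu'] at this
  have hkT : LinearMap.ker jp.adjoint.toFun = ⊥ :=
    ker_eq_bot_of_graph fun z hz => eq_zero_of_mem_adjoint_graph hT h.left_dense_range hz
  -- The functional `jm z ↦ ⟨y, z⟩` is bounded by `‖v‖`. As `‖jm z‖ = ‖jp* z‖`, so is `jp* z ↦ ⟨y,
  -- z⟩`, which puts `y` in `Dom R*`.
  let R := jp.adjoint.inverse
  have hRd : Dense (R.domain : Set Hp) := by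
    rw [inverse_domain]
    exact dense_range_adjoint hT h.left_embedding.closed hkp
  have hyR : y ∈ R.adjoint.domain := by
    rw [mem_adjoint_domain_iff]
    refine AddMonoidHomClass.continuous_of_bound _ ‖v‖ fun x => ?_
    change ‖inner 𝕜 y (R x)‖ ≤ _
    obtain ⟨z, hz, hz'⟩ :=
      (mem_graph_iff _).1 ((mem_inverse_graph_iff hkT).1 (R.mem_graph x))
    dsimp only at hz hz'
    let z' : jm.domain := ⟨z, h.adjoint_domain_le z.2⟩
    have hn : ‖jm z'‖ = ‖(x : Hp)‖ := by
      rw [h.norm_apply_eq z', ← hz']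
      rfl
    rw [← hz, norm_inner_symm, ← hv' z', Submodule.coe_norm, ← hn, mul_comm]
    exact norm_inner_le_norm _ _
  have hw := (mem_adjoint_graph_iff hRd).1 (R.adjoint.mem_graph ⟨y, hyR⟩)
  -- `⟨jp* z, R* y⟩ = ⟨z, y⟩` for all `z`, so `jp** = jp` sends `R* y` to `y`.
  have hmem : (R.adjoint ⟨y, hyR⟩, y) ∈ jp.graph :=
    h.left_embedding.closed.mem_graph_of_forall_inner_adjoint hT fun z => by
      obtain ⟨u, hu, hu'⟩ := (mem_graph_iff _).1 (mem_inverse_graph hkT z)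
      have := hw u
      rwa [hu, hu'] at this
  rw [inverse_domain]
  obtain ⟨x, -, hx⟩ := (mem_graph_iff _).1 hmem
  exact ⟨x, hx⟩

theorem IsTriplet.inverse (h : IsTriplet ιp ι₀ ιm jp jm)
    (hιp : Function.Injective ιp) (hι₀ : Function.Injective ι₀) :
    IsTriplet ιm ι₀ ιp jm.inverse jp.inverse where
  left_embedding := h.right_embedding.inverse hι₀ h.right_dense_range
  left_dense_range := h.right_embedding.denseRange_inverse hι₀
  right_embedding := h.left_embedding.inverse hιp h.left_dense_range
  right_dense_range := h.left_embedding.denseRange_inverse hιp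
  adjoint_domain_le := h.adjoint_inverse_domain_le hιp hι₀
  norm_eq := h.isLUB_inverse hιp hι₀

/-- Both sides relate `y` to `u` when `⟨z, y⟩` equals, for all `z` in `Dom jm`, the common value
`⟨jm z, jm u⟩ = ⟨jp* z, jp* u⟩`. -/
theorem IsTriplet.kernelOperator_inverse (h : IsTriplet ιp ι₀ ιm jp jm)
    (hιp : Function.Injective ιp) (hι₀ : Function.Injective ι₀) :
    kernelOperator jm.inverse = hamiltonian jp := by
  have hkm := h.right_embedding.ker_eq_bot hι₀
  have hT := h.left_embedding.dense_domain
  have hSd := (h.right_embedding.inverse hι₀ h.right_dense_range).dense_domain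
  refine eq_of_eq_graph (Submodule.ext fun ⟨y, u⟩ => ?_)
  rw [hamiltonian, mem_inverse_graph_iff (h.kernelOperator_ker_eq_bot hιp), kernelOperator,
    kernelOperator, mem_opMul_graph_iff, mem_opMul_graph_iff]
  constructor
  · rintro ⟨v, hv, hvu⟩
    obtain ⟨u, rfl, rfl⟩ := (mem_graph_iff _).1 ((mem_inverse_graph_iff hkm).1 hvu)
    refine ⟨_, jp.adjoint.mem_graph (Submodule.inclusion h.domain_le_adjoint_domain u), ?_⟩
    -- Closedness of `jp` turns this weak identity into `jp (jp* u) = y`.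
    refine h.left_embedding.closed.mem_graph_of_forall_inner_adjoint hT fun z => ?_
    let z' : jm.domain := ⟨z, h.adjoint_domain_le z.2⟩
    obtain ⟨x, hx, hx'⟩ := (mem_graph_iff _).1 (mem_inverse_graph hkm z')
    dsimp only at hx hx'
    have := (mem_adjoint_graph_iff hSd).1 hv x
    rw [hx, hx', h.inner_apply_eq] at this
    exact this
  · rintro ⟨w, huw, hwy⟩
    obtain ⟨u₀, rfl, rfl⟩ := (mem_graph_iff _).1 huw
    obtain ⟨w, hw, rfl⟩ := (mem_graph_iff _).1 hwy
    dsimp only at hw ⊢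
    let u : jm.domain := ⟨u₀, h.adjoint_domain_le u₀.2⟩
    refine ⟨jm u, ?_, mem_inverse_graph hkm u⟩
    rw [mem_adjoint_graph_iff hSd]
    intro x
    obtain ⟨z, hz, hz'⟩ :=
      (mem_graph_iff _).1 ((mem_inverse_graph_iff hkm).1 (jm.inverse.mem_graph x))
    dsimp only at hz hz'
    rw [← hz, ← hz', h.inner_apply_eq]
    change inner 𝕜 _ (jp.adjoint u₀) = _
    rw [← hw]
    exact adjoint_isFormalAdjoint hT _ w

theorem IsTriplet.hamiltonian_inverse (h : IsTriplet ιp ι₀ ιm jp jm)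
    (hιp : Function.Injective ιp) (hι₀ : Function.Injective ι₀) :
    hamiltonian jm.inverse = kernelOperator jp := by
  rw [hamiltonian, h.kernelOperator_inverse hιp hι₀, hamiltonian,
    inverse_inverse (h.kernelOperator_ker_eq_bot hιp)]

end Triplet

end CloselyEmbedded


theorem proposition5p3 {𝕜 Hp H₀ Hm V : Type*} [RCLike 𝕜]
    [NormedAddCommGroup Hp] [InnerProductSpace 𝕜 Hp] [CompleteSpace Hp]
    [NormedAddCommGroup H₀] [InnerProductSpace 𝕜 H₀] [CompleteSpace H₀]
    [NormedAddCommGroup Hm] [InnerProductSpace 𝕜 Hm] [CompleteSpace Hm]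
    [AddCommGroup V] [Module 𝕜 V]
    (ιp : Hp →ₗ[𝕜] V) (ι₀ : H₀ →ₗ[𝕜] V) (ιm : Hm →ₗ[𝕜] V)
    (hιp : Function.Injective ιp) (hι₀ : Function.Injective ι₀) (hιm : Function.Injective ιm)
    (jp : Hp →ₗ.[𝕜] H₀) (jm : H₀ →ₗ.[𝕜] Hm)
    (h : CloselyEmbedded.IsTriplet ιp ι₀ ιm jp jm) :
    CloselyEmbedded.IsTriplet ιm ι₀ ιp jm.inverse jp.inverse ∧
      CloselyEmbedded.hamiltonian jm.inverse = CloselyEmbedded.kernelOperator jp ∧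
      CloselyEmbedded.kernelOperator jm.inverse = CloselyEmbedded.hamiltonian jp :=
  ⟨h.inverse hιp hι₀, h.hamiltonian_inverse hιp hι₀, h.kernelOperator_inverse hιp hι₀⟩
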